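/- All topological groups are assumed to be Hausdorff. Let $\mathcal G$ be a class of topological groups such that every topological group is isomorphic (as a topological group) with a topological subgroup, i.e. a subgroup with the subspace topology, of the direct product (with the product topology) of a family of groups from $\mathcal G$. Then every topological group is isomorphic with a topological subgroup of a single group from $\mathcal G$. Put otherwise, let $S(\mathcal G)$ denote the class of all topological groups isomorphic with a topological subgroup of a member of $\mathcal G$, and $P(\mathcal G)$ the class of all topological groups isomorphic with the direct product of a family of members of $\mathcal G$. If $S(P(\mathcal G))$ is the class of all topological groups, then $S(\mathcal G)$ is already the class of all topological groups. -/

import Mathlib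

universe u

/-- A Hausdorff topological group (with underlying set in the universe `u`). -/
structure HausdorffTopGroup : Type (u + 1) where
  carrier : Type u
  [group : Group carrier]
  [topologicalSpace : TopologicalSpace carrier]
  [isTopologicalGroup : IsTopologicalGroup carrier]
  [t2Space : T2Space carrier]

namespace HausdorffTopGroup

instance : CoeSort HausdorffTopGroup.{u} (Type u) := ⟨carrier⟩

attribute [instance] group topologicalSpace isTopologicalGroup t2Space

/-- `G` is isomorphic, as a topological group, with a topological subgroup of `K`
(a subgroup carrying the subspace topology). -/
def IsomorphicToSubgroup (G K : Type*) [Group G] [TopologicalSpace G]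
    [Group K] [TopologicalSpace K] : Prop :=
  ∃ H : Subgroup K, Nonempty (G ≃ₜ* H)

/-- The class `S(𝒢)` of all groups isomorphic with a topological subgroup of a member of `𝒢`. -/
def S (𝒢 : Set HausdorffTopGroup.{u}) : Set HausdorffTopGroup.{u} :=
  {G | ∃ K ∈ 𝒢, IsomorphicToSubgroup G K}

/-- The class `P(𝒢)` of all groups isomorphic with the direct product (with the product topology)
of a family of members of `𝒢`. -/
def P (𝒢 : Set HausdorffTopGroup.{u}) : Set HausdorffTopGroup.{u} :=
  {G | ∃ (ι : Type u) (F : ι → HausdorffTopGroup.{u}),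
    (∀ i, F i ∈ 𝒢) ∧ Nonempty (G ≃ₜ* (∀ i, F i))}

end HausdorffTopGroup

/-! It suffices to embed `G` in a group `K` with an element `z ≠ 1` such that every continuous
homomorphism `φ` on `K` with `φ z ≠ 1` is an embedding on `G`: if `K` lies in a product, some
coordinate does not kill `z`, and `G` embeds in that factor.

`K` is the Hausdorff quotient of a semidirect product of `G` with a Heisenberg group over a
seminormed space `X` with an invariant continuous bilinear form `B`, and `z` is the central element
1. If `φ g` is near 1, so is `φ` of the commutator `g x - x`, and of its `n`-th power. When `b = B
(g x - x, y)` is not small, the commutator of that power with the short vector `y / (n b)` is `z`,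
which forces `φ z` near 1 (`isInducing_comp_inl`). So `φ` controls the coefficients `B (g x - x,
y)`.

These must detect the topology of `G`. `X` is spanned by one copy of `G` per invariant pseudometric
`d`, and `B` has kernel `d` on that copy, so basis vectors give `d g 1`. Duality with 1/2-Hölder
functions makes both `B` and the action continuous. -/

open Topology Filter Set

/-! ### Invariant pseudometrics on a topological group -/

/-- A continuous left-invariant pseudometric on a topological group, bounded by `1`. -/
structure IsInvariantPseudometric {G : Type*} [Group G] [TopologicalSpace G]
    (d : G → G → ℝ) : Prop where
  self : ∀ a, d a a = 0
  symm : ∀ a b, d a b = d b a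
  triangle : ∀ a b c, d a c ≤ d a b + d b c
  le_one : ∀ a b, d a b ≤ 1
  mul_left : ∀ g a b, d (g * a) (g * b) = d a b
  tendsto : Tendsto (d 1) (𝓝 1) (𝓝 0)

namespace IsInvariantPseudometric

variable {G : Type*} [Group G] [TopologicalSpace G] {d : G → G → ℝ}

theorem nonneg (hd : IsInvariantPseudometric d) (a b : G) : 0 ≤ d a b := by
  linarith [hd.self a, hd.triangle a b a, hd.symm a b]

theorem abs_sub_le (hd : IsInvariantPseudometric d) (a a' b : G) :
    |d a b - d a' b| ≤ d a a' := by
  rw [abs_sub_le_iff]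
  constructor <;> linarith [hd.triangle a a' b, hd.triangle a' a b, hd.symm a a']

/-- A left-invariant structure given by a sequence of neighbourhoods of the identity is induced by
an invariant pseudometric. -/
theorem exists_of_seq (V : ℕ → Set G) (hV : ∀ n, V n ∈ 𝓝 1) (hinv : ∀ n, ∀ a ∈ V n, a⁻¹ ∈ V n)
    (hmul : ∀ n, ∀ a ∈ V (n + 1), ∀ b ∈ V (n + 1), a * b ∈ V n) :
    ∃ d : G → G → ℝ, IsInvariantPseudometric d ∧ ∃ ε > 0, ∀ g, d 1 g < ε → g ∈ V 0 := by
  have hone : ∀ n, (1 : G) ∈ V n := fun n => mem_of_mem_nhds (hV n)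
  have hanti : Antitone V := antitone_nat_of_succ_le fun n a ha => by
    simpa using hmul n a ha 1 (hone _)
  let E : ℕ → Set (G × G) := fun n => {p | p.1⁻¹ * p.2 ∈ V n}
  have hE : (⨅ n, 𝓟 (E n)).HasBasis (fun _ : ℕ => True) E :=
    hasBasis_iInf_principal (directed_of_isDirected_le fun m n hmn p hp => hanti hmn hp)
  let C : UniformSpace.Core G :=
    { uniformity := ⨅ n, 𝓟 (E n)
      refl := by
        rw [hE.ge_iff]
        rintro n - ⟨a, b⟩ hab
        obtain rfl : a = b := by simpa using hab
        simpa [E] using hone n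
      symm := by
        rw [hE.tendsto_iff hE]
        refine fun n _ => ⟨n, trivial, fun p hp => ?_⟩
        simpa [E] using hinv n _ hp
      comp := by
        rw [hE.ge_iff]
        refine fun n _ => mem_of_superset (mem_lift' (hE.mem_of_mem (i := n + 1) trivial)) ?_
        rintro ⟨a, b⟩ ⟨c, hac, hcb⟩
        simpa [E, mul_assoc] using hmul n _ hac _ hcb }
  let : UniformSpace G := UniformSpace.ofCore C
  have hU : (uniformity G).HasBasis (fun _ : ℕ => True) E := hE
  have : (uniformity G).IsCountablyGenerated := hU.isCountablyGenerated
  let M : PseudoMetricSpace G := UniformSpace.pseudoMetricSpace G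
  let e : G → G → ℝ := M.dist
  have he : (uniformity G).HasBasis (fun ε : ℝ => 0 < ε) fun ε => {p | e p.1 p.2 < ε} :=
    @Metric.uniformity_basis_dist G M
  have hself : ∀ a, e a a = 0 := M.dist_self
  have hsymm : ∀ a b, e a b = e b a := M.dist_comm
  have htri : ∀ a b c, e a c ≤ e a b + e b c := M.dist_triangle
  clear_value e
  have hbdd : ∀ a b, BddAbove (range fun g => min 1 (e (g * a) (g * b))) := fun a b =>
    ⟨1, by rintro _ ⟨g, rfl⟩; exact min_le_left _ _⟩
  have hnn : ∀ a b, 0 ≤ e a b := fun a b => by linarith [hself a, htri a b a, hsymm a b]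
  -- The metrization `e` need not be invariant. The supremum over left translates is, and it stays
  -- continuous at 1 because the entourages `E n` are left-invariant; truncation at 1 keeps it
  -- finite.
  refine ⟨fun a b => ⨆ g, min 1 (e (g * a) (g * b)), ⟨fun a => ?_, fun a b => ?_, fun a b c => ?_,
    fun a b => ciSup_le fun g => min_le_left _ _, fun g a b => ?_, ?_⟩, ?_⟩
  · simp [hself]
  · simp [hsymm]
  · refine ciSup_le fun g => ?_
    have h1 := le_ciSup (hbdd a b) g
    have h2 := le_ciSup (hbdd b c) g
    have h3 := htri (g * a) (g * b) (g * c)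
    have h4 := hnn (g * a) (g * b)
    have h5 := hnn (g * b) (g * c)
    refine le_trans ?_ (add_le_add h1 h2)
    rcases le_total 1 (e (g * a) (g * b)) with h | h <;>
    rcases le_total 1 (e (g * b) (g * c)) with h' | h' <;>
    simp [h, h'] <;> grind
  · simp only [← mul_assoc]
    exact (Equiv.mulRight g).surjective.iSup_comp (fun k => min 1 (e (k * a) (k * b)))
  · rw [Metric.tendsto_nhds]
    intro ε hε
    obtain ⟨n, -, hn⟩ := hU.mem_iff.1 (he.mem_of_mem (half_pos hε))
    filter_upwards [hV n] with a ha
    have h0 : 0 ≤ ⨆ g, min 1 (e (g * 1) (g * a)) :=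
      Real.iSup_nonneg fun g => le_min zero_le_one (hnn _ _)
    rw [Real.dist_eq, sub_zero, abs_of_nonneg h0]
    refine lt_of_le_of_lt (ciSup_le fun g => (min_le_right _ _).trans ?_) (half_lt_self hε)
    have : (g * 1, g * a) ∈ E n := by simpa [E] using ha
    exact (hn this).le
  · obtain ⟨ε, hε, h⟩ := he.mem_iff.1 (hU.mem_of_mem (i := 0) trivial)
    refine ⟨min 1 ε, lt_min one_pos hε, fun g hg => ?_⟩
    have h1 := (le_ciSup (hbdd 1 g) 1).trans_lt hg
    have h2 : e 1 g < ε := by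
      simp only [one_mul] at h1
      grind
    simpa [E] using h (show ((1 : G), g) ∈ {p : G × G | e p.1 p.2 < ε} from h2)

theorem exists_of_mem_nhds_one [IsTopologicalGroup G] {U : Set G} (hU : U ∈ 𝓝 1) :
    ∃ d : G → G → ℝ, IsInvariantPseudometric d ∧ ∃ ε > 0, ∀ g, d 1 g < ε → g ∈ U := by
  have step : ∀ W : {W : Set G // W ∈ 𝓝 1}, ∃ W' : {W : Set G // W ∈ 𝓝 1},
      (∀ a ∈ W'.1, a⁻¹ ∈ W'.1) ∧ ∀ a ∈ W'.1, ∀ b ∈ W'.1, a * b ∈ W.1 := by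
    rintro ⟨W, hW⟩
    obtain ⟨V, hV, hV1, hVinv, hVmul⟩ := exists_closed_nhds_one_inv_eq_mul_subset hW
    refine ⟨⟨V, hV⟩, fun a ha => ?_, fun a ha b hb => hVmul (mul_mem_mul ha hb)⟩
    exact Set.mem_inv.1 (hVinv.symm ▸ ha)
  choose f hf hf' using step
  -- The sequence starts at `f U` rather than `U`, since `U` need not be symmetric.
  let V : ℕ → {W : Set G // W ∈ 𝓝 1} := fun n => f^[n + 1] ⟨U, hU⟩
  have hs : ∀ n, V (n + 1) = f (V n) := fun n => Function.iterate_succ_apply' f _ _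
  obtain ⟨d, hd, ε, hε, h⟩ := exists_of_seq (fun n => (V n).1) (fun n => (V n).2)
    (fun n => by rcases n with _ | n; exacts [hf _, by rw [hs]; exact hf _])
    (fun n => by rw [hs]; exact hf' _)
  exact ⟨d, hd, ε, hε, fun g hg => by
    simpa using hf' ⟨U, hU⟩ g (h g hg) 1 (mem_of_mem_nhds (V 0).2)⟩

end IsInvariantPseudometric

/-! ### The Heisenberg extension -/

/-- A continuous action of `G` by linear maps on a topological vector space, together with an
invariant continuous bilinear form. -/
structure InvariantBilinForm (G X : Type*) [Group G] [TopologicalSpace G] [AddCommGroup X]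
    [Module ℝ X] [TopologicalSpace X] where
  act : G →* (X →ₗ[ℝ] X)
  form : X →ₗ[ℝ] X →ₗ[ℝ] ℝ
  form_act : ∀ g x y, form (act g x) (act g y) = form x y
  continuous_act : Continuous fun p : G × X => act p.1 p.2
  continuous_form : Continuous fun p : X × X => form p.1 p.2

namespace InvariantBilinForm

variable {G X : Type*} [Group G] [TopologicalSpace G] [AddCommGroup X]
    [Module ℝ X] [TopologicalSpace X]

/-- The semidirect product of `G` with the Heisenberg group of an invariant bilinear form. -/
@[ext]
structure Heisenberg (D : InvariantBilinForm G X) where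
  base : G
  left : X
  right : X
  center : ℝ

namespace Heisenberg

variable {D : InvariantBilinForm G X}

instance : One (Heisenberg D) := ⟨⟨1, 0, 0, 0⟩⟩

instance : Mul (Heisenberg D) := ⟨fun a b => ⟨a.base * b.base, a.left + D.act a.base b.left,
  a.right + D.act a.base b.right,
  a.center + b.center + D.form a.left (D.act a.base b.right)⟩⟩

instance : Inv (Heisenberg D) := ⟨fun a => ⟨a.base⁻¹, -D.act a.base⁻¹ a.left,
  -D.act a.base⁻¹ a.right, -a.center + D.form a.left a.right⟩⟩

theorem one_def : (1 : Heisenberg D) = ⟨1, 0, 0, 0⟩ := rfl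

theorem mul_def (a b : Heisenberg D) : a * b = ⟨a.base * b.base, a.left + D.act a.base b.left,
  a.right + D.act a.base b.right,
  a.center + b.center + D.form a.left (D.act a.base b.right)⟩ := rfl

theorem inv_def (a : Heisenberg D) : a⁻¹ = ⟨a.base⁻¹, -D.act a.base⁻¹ a.left,
  -D.act a.base⁻¹ a.right, -a.center + D.form a.left a.right⟩ := rfl

instance : Group (Heisenberg D) := Group.ofLeftAxioms
  (fun a b c => by
    simp only [mul_def, mul_assoc, map_mul, map_add, LinearMap.add_apply, Module.End.mul_apply,
      D.form_act, Heisenberg.mk.injEq, true_and, add_assoc]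
    ring)
  (fun a => by simp [mul_def, one_def])
  (fun a => by simp [mul_def, one_def, inv_def, D.form_act])

/-- The underlying quadruple. -/
def toProd (a : Heisenberg D) : G × X × X × ℝ := (a.base, a.left, a.right, a.center)

instance : TopologicalSpace (Heisenberg D) := .induced toProd inferInstance

theorem continuous_toProd : Continuous (toProd (D := D)) := continuous_induced_dom

theorem continuous_base : Continuous (base (D := D)) := continuous_toProd.fst

theorem continuous_left : Continuous (left (D := D)) := continuous_toProd.snd.fst

theorem continuous_right : Continuous (right (D := D)) := continuous_toProd.snd.snd.fst

theorem continuous_center : Continuous (center (D := D)) := continuous_toProd.snd.snd.snd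

theorem continuous_mk {Y : Type*} [TopologicalSpace Y] {f : Y → G} {x y : Y → X} {t : Y → ℝ}
    (hf : Continuous f) (hx : Continuous x) (hy : Continuous y) (ht : Continuous t) :
    Continuous fun p => (⟨f p, x p, y p, t p⟩ : Heisenberg D) :=
  continuous_induced_rng.2 (hf.prodMk (hx.prodMk (hy.prodMk ht)))

instance [IsTopologicalGroup G] [IsTopologicalAddGroup X] :
    IsTopologicalGroup (Heisenberg D) where
  continuous_mul := by
    have hact {Y : Type _} [TopologicalSpace Y] {f : Y → G} {x : Y → X} (hf : Continuous f)
      (hx : Continuous x) : Continuous fun p => D.act (f p) (x p) :=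
      D.continuous_act.comp (hf.prodMk hx)
    have h1 := continuous_fst (X := Heisenberg D) (Y := Heisenberg D)
    have h2 := continuous_snd (X := Heisenberg D) (Y := Heisenberg D)
    have hg := continuous_base.comp h1
    have hr := hact hg (continuous_right.comp h2)
    exact continuous_mk (hg.mul (continuous_base.comp h2))
      ((continuous_left.comp h1).add (hact hg (continuous_left.comp h2)))
      ((continuous_right.comp h1).add hr)
      (((continuous_center.comp h1).add (continuous_center.comp h2)).add
        (D.continuous_form.comp ((continuous_left.comp h1).prodMk hr)))
  continuous_inv := continuous_mk continuous_base.inv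
    (D.continuous_act.comp (continuous_base.inv.prodMk continuous_left)).neg
    (D.continuous_act.comp (continuous_base.inv.prodMk continuous_right)).neg
    (continuous_center.neg.add (D.continuous_form.comp (continuous_left.prodMk continuous_right)))

/-- The inclusion of `G`. -/
def inl : G →* Heisenberg D where
  toFun g := ⟨g, 0, 0, 0⟩
  map_one' := rfl
  map_mul' g h := by simp [mul_def]

theorem inl_mul_left (g : G) (x : X) : (inl g * ⟨1, x, 0, 0⟩ : Heisenberg D) =
    ⟨1, D.act g x - x, 0, 0⟩ * ⟨1, x, 0, 0⟩ * inl g := by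
  simp [mul_def, inl]

theorem left_mul_right (x y : X) : (⟨1, x, 0, 0⟩ * ⟨1, 0, y, 0⟩ : Heisenberg D) =
    ⟨1, 0, 0, D.form x y⟩ * ⟨1, 0, y, 0⟩ * ⟨1, x, 0, 0⟩ := by
  simp [mul_def]

theorem left_pow (x : X) (n : ℕ) : (⟨1, x, 0, 0⟩ ^ n : Heisenberg D) = ⟨1, n • x, 0, 0⟩ := by
  induction n with
  | zero => simp [one_def]
  | succ n ih => simp [pow_succ, ih, mul_def, add_smul]

theorem isInducing_inl : IsInducing (inl (D := D)) :=
  .of_comp (continuous_mk continuous_id continuous_const continuous_const continuous_const)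
    continuous_base .id

/-- If coefficients of the form detect the topology of `G`, then every continuous homomorphism on
the Heisenberg extension that does not kill the central element `1` is inducing on `G`. -/
theorem isInducing_comp_inl [IsTopologicalGroup G] [IsTopologicalAddGroup X] [ContinuousSMul ℝ X]
    (hD : ∀ U ∈ 𝓝 (1 : G), ∃ x y : X, ∃ ε > 0, ∀ g, |D.form (D.act g x - x) y| < ε → g ∈ U)
    {F : Type*} [Group F] [TopologicalSpace F] [IsTopologicalGroup F] [T2Space F]
    (φ : Heisenberg D →* F) (hφ : Continuous φ) (hz : φ ⟨1, 0, 0, 1⟩ ≠ 1) :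
    IsInducing (φ.comp inl) := by
  have hcont : Continuous (φ.comp inl) := hφ.comp isInducing_inl.continuous
  refine IsTopologicalGroup.isInducing_iff_nhds_one.2 (le_antisymm ?_ ?_)
  · simpa using (hcont.tendsto 1).le_comap
  intro U hU
  obtain ⟨x, y, ε, hε, hxy⟩ := hD U hU
  have hV : {φ ⟨1, 0, 0, 1⟩}ᶜ ∈ 𝓝 (1 : F) := isOpen_compl_singleton.mem_nhds (by simpa using hz.symm)
  have hcomm : Tendsto (fun p : F × F => p.1 * p.2 * p.1⁻¹ * p.2⁻¹) (𝓝 1 ×ˢ 𝓝 1) (𝓝 1) := by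
    rw [← nhds_prod_eq]
    have : Continuous (fun p : F × F => p.1 * p.2 * p.1⁻¹ * p.2⁻¹) := by fun_prop
    simpa using this.tendsto (1, 1)
  obtain ⟨W, hW, hWV⟩ := mem_prod_same_iff.1 (hcomm hV)
  have hright : Tendsto (fun t : ℝ => φ ⟨1, 0, t • y, 0⟩) (𝓝 0) (𝓝 1) := by
    have : Continuous (fun t : ℝ => φ ⟨1, 0, t • y, 0⟩) :=
      hφ.comp (continuous_mk continuous_const continuous_const
        (continuous_id.smul continuous_const) continuous_const)
    have h := this.tendsto 0
    rw [zero_smul, ← one_def, map_one] at h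
    exact h
  obtain ⟨δ, hδ, hδW⟩ := Metric.mem_nhds_iff.1 (hright hW)
  -- This makes `1 / (n * |b|) < δ` as soon as `|b| ≥ ε`. The choice precedes `g`, so one
  -- neighbourhood serves for the `n`-th power.
  obtain ⟨n, hn⟩ := exists_nat_gt (1 / (δ * ε))
  have hn0 : (0 : ℝ) < n := lt_trans (by positivity) hn
  have hpow : Tendsto (fun f : F => (f * φ ⟨1, x, 0, 0⟩ * f⁻¹ * (φ ⟨1, x, 0, 0⟩)⁻¹) ^ n)
      (𝓝 1) (𝓝 1) := by
    have : Continuous (fun f : F => (f * φ ⟨1, x, 0, 0⟩ * f⁻¹ * (φ ⟨1, x, 0, 0⟩)⁻¹) ^ n) := by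
      fun_prop
    simpa using this.tendsto 1
  refine mem_comap.2 ⟨_, by simpa using hpow hW, fun g hg => hxy g ?_⟩
  by_contra! hlt
  set b := D.form (D.act g x - x) y with hb
  have hb0 : b ≠ 0 := fun h => by simp [h] at hlt; linarith
  have hg' : φ ⟨1, n • (D.act g x - x), 0, 0⟩ ∈ W := by
    have h := inl_mul_left (D := D) g x
    rw [← mul_inv_eq_iff_eq_mul, ← mul_inv_eq_iff_eq_mul] at h
    rw [← left_pow, ← h]
    simpa using hg
  have ht : φ ⟨1, 0, (1 / (n * b)) • y, 0⟩ ∈ W := by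
    refine hδW ?_
    rw [mem_ball_zero_iff, Real.norm_eq_abs, abs_div, abs_mul, abs_one, abs_of_pos hn0,
      div_lt_iff₀ (by positivity)]
    rw [div_lt_iff₀ (by positivity)] at hn
    calc 1 < n * (δ * ε) := hn
      _ ≤ n * (δ * |b|) := by gcongr
      _ = δ * (n * |b|) := by ring
  -- The commutator of these two elements of `W` is the image of the central element 1, which `W`
  -- was chosen to exclude.
  refine hWV (mk_mem_prod hg' ht) ?_
  have h := left_mul_right (D := D) (n • (D.act g x - x)) ((1 / (n * b)) • y)
  rw [← mul_inv_eq_iff_eq_mul, ← mul_inv_eq_iff_eq_mul] at h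
  have hval : D.form (n • (D.act g x - x)) ((1 / (n * b)) • y) = 1 := by
    rw [map_nsmul, LinearMap.smul_apply, map_smul, ← hb]
    simp only [nsmul_eq_mul, smul_eq_mul]
    field_simp
  rw [hval] at h
  simp only [mem_singleton_iff, ← map_mul, ← map_inv, h]

end Heisenberg

end InvariantBilinForm

/-! ### The seminormed space dual to Hölder functions -/

section

variable (G : Type*) [Group G] [TopologicalSpace G]

/-- The invariant pseudometrics of a topological group. -/
abbrev InvariantPseudometric := {d : G → G → ℝ // IsInvariantPseudometric d}

/-- The vector space spanned by a copy of `G` for each invariant pseudometric on `G`. -/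
abbrev PseudometricFreeSpace := (InvariantPseudometric G × G) →₀ ℝ

/-- Functions bounded by `c` whose restriction to each copy of `G` has Hölder constant `c` and
exponent `1 / 2`. -/
def holderTest (c : ℝ) : Set (InvariantPseudometric G × G → ℝ) :=
  {h | (∀ s, |h s| ≤ c) ∧ ∀ d a b, |h (d, a) - h (d, b)| ≤ c * √(d.1 a b)}

end

namespace PseudometricFreeSpace

variable {G : Type*} [Group G] [TopologicalSpace G]

open Finsupp

theorem zero_mem_holderTest : (0 : InvariantPseudometric G × G → ℝ) ∈ holderTest G 1 :=
  ⟨by simp, fun d a b => by simp⟩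

instance : Nonempty (holderTest G 1) := ⟨⟨0, zero_mem_holderTest⟩⟩

theorem bddAbove_range (x : PseudometricFreeSpace G) :
    BddAbove (range fun h : holderTest G 1 => |linearCombination ℝ h.1 x|) := by
  refine ⟨∑ s ∈ x.support, |x s|, ?_⟩
  rintro _ ⟨h, rfl⟩
  change |linearCombination ℝ h.1 x| ≤ _
  rw [linearCombination_apply, Finsupp.sum]
  refine (Finset.abs_sum_le_sum_abs _ _).trans (Finset.sum_le_sum fun s _ => ?_)
  rw [smul_eq_mul, abs_mul]
  exact mul_le_of_le_one_right (abs_nonneg _) (h.2.1 s)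

/-- The seminorm dual to the Hölder functions. -/
noncomputable def holderSeminorm : Seminorm ℝ (PseudometricFreeSpace G) :=
  Seminorm.of (fun x => ⨆ h : holderTest G 1, |linearCombination ℝ h.1 x|)
    (fun x y => ciSup_le fun h => by
      rw [map_add]
      exact (abs_add_le _ _).trans
        (add_le_add (le_ciSup (bddAbove_range x) h) (le_ciSup (bddAbove_range y) h)))
    (fun c x => by
      simp only [map_smul, smul_eq_mul, abs_mul, Real.norm_eq_abs]
      rw [Real.mul_iSup_of_nonneg (abs_nonneg c)])

noncomputable instance : SeminormedAddCommGroup (PseudometricFreeSpace G) :=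
  holderSeminorm.toAddGroupSeminorm.toSeminormedAddCommGroup

noncomputable instance : NormedSpace ℝ (PseudometricFreeSpace G) where
  norm_smul_le c x := (map_smul_eq_mul holderSeminorm c x).le

theorem norm_le {x : PseudometricFreeSpace G} {c : ℝ}
    (h : ∀ f ∈ holderTest G 1, |linearCombination ℝ f x| ≤ c) : ‖x‖ ≤ c :=
  ciSup_le fun f : holderTest G 1 => h f.1 f.2

theorem abs_linearCombination_le {c : ℝ} {h : InvariantPseudometric G × G → ℝ}
    (hh : h ∈ holderTest G c) (x : PseudometricFreeSpace G) :
    |linearCombination ℝ h x| ≤ c * ‖x‖ := by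
  have key : ∀ f ∈ holderTest G 1, |linearCombination ℝ f x| ≤ ‖x‖ := fun f hf =>
    le_ciSup (bddAbove_range x) ⟨f, hf⟩
  -- An index `s` is needed to deduce `0 ≤ c`; for `c > 0`, rescale `h` by `c⁻¹`.
  rcases isEmpty_or_nonempty (InvariantPseudometric G × G) with hS | ⟨⟨s⟩⟩
  · simp [Subsingleton.elim x 0]
  rcases ((abs_nonneg _).trans (hh.1 s)).eq_or_lt with rfl | hc
  · obtain rfl : h = 0 := funext fun s => by simpa using hh.1 s
    simp
  have := key (c⁻¹ • h) ⟨fun s => ?_, fun d a b => ?_⟩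
  · have e : linearCombination ℝ (c⁻¹ • h) x = c⁻¹ * linearCombination ℝ h x := by
      simp only [linearCombination_apply, Finsupp.sum, Finset.mul_sum, Pi.smul_apply, smul_eq_mul]
      exact Finset.sum_congr rfl fun _ _ => by ring
    rwa [e, abs_mul, abs_of_pos (inv_pos.2 hc), inv_mul_le_iff₀ hc] at this
  · rw [Pi.smul_apply, smul_eq_mul, abs_mul, abs_of_pos (inv_pos.2 hc), inv_mul_le_iff₀ hc, mul_one]
    exact hh.1 s
  · rw [Pi.smul_apply, Pi.smul_apply, smul_eq_mul, smul_eq_mul, ← mul_sub, abs_mul,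
      abs_of_pos (inv_pos.2 hc), inv_mul_le_iff₀ hc, one_mul]
    exact hh.2 d a b

open Classical in
/-- The kernel that restricts to `d` on the copy of `G` indexed by `d`. -/
noncomputable def kernel (s t : InvariantPseudometric G × G) : ℝ :=
  if s.1 = t.1 then s.1.1 s.2 t.2 else 0

theorem abs_kernel_le (s t : InvariantPseudometric G × G) : |kernel s t| ≤ 1 := by
  unfold kernel
  split_ifs
  · rw [abs_of_nonneg (s.1.2.nonneg _ _)]
    exact s.1.2.le_one _ _
  · simp

theorem kernel_comm (s t : InvariantPseudometric G × G) : kernel s t = kernel t s := by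
  unfold kernel
  by_cases h : s.1 = t.1
  · rw [if_pos h, if_pos h.symm, ← h, s.1.2.symm]
  · rw [if_neg h, if_neg (Ne.symm h)]

theorem abs_kernel_sub_le (d : InvariantPseudometric G) (a a' : G)
    (t : InvariantPseudometric G × G) : |kernel (d, a) t - kernel (d, a') t| ≤ d.1 a a' := by
  unfold kernel
  dsimp only
  split_ifs
  · exact d.2.abs_sub_le _ _ _
  · simpa using d.2.nonneg a a'

theorem le_sqrt (d : InvariantPseudometric G) (a b : G) : d.1 a b ≤ √(d.1 a b) :=
  Real.le_sqrt_of_sq_le (by nlinarith [d.2.nonneg a b, d.2.le_one a b])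

theorem sqrt_le_one (d : InvariantPseudometric G) (a b : G) : √(d.1 a b) ≤ 1 :=
  Real.sqrt_le_one.2 (d.2.le_one a b)

theorem kernel_mem_holderTest (s : InvariantPseudometric G × G) :
    kernel s ∈ holderTest G 1 := by
  refine ⟨abs_kernel_le s, fun d a b => ?_⟩
  rw [kernel_comm s, kernel_comm s, one_mul]
  exact (abs_kernel_sub_le d a b s).trans (le_sqrt d a b)

/-- The mixed difference of the kernel is at most twice each of the two distances, hence at most
twice their geometric mean. This is why the exponent is `1 / 2`: each variable receives one square
root. -/
theorem kernel_sub_mem_holderTest (d : InvariantPseudometric G) (a a' : G) :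
    kernel (d, a) - kernel (d, a') ∈ holderTest G (2 * √(d.1 a a')) := by
  refine ⟨fun s => (abs_kernel_sub_le d a a' s).trans ?_, fun d' b b' => ?_⟩
  · linarith [le_sqrt d a a', Real.sqrt_nonneg (d.1 a a')]
  have h1 : |(kernel (d, a) - kernel (d, a')) (d', b) -
      (kernel (d, a) - kernel (d, a')) (d', b')| ≤ 2 * d.1 a a' := by
    have e1 := abs_kernel_sub_le d a a' (d', b)
    have e2 := abs_kernel_sub_le d a a' (d', b')
    simp only [Pi.sub_apply]
    rw [abs_le] at *
    constructor <;> linarith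
  have h2 : |(kernel (d, a) - kernel (d, a')) (d', b) -
      (kernel (d, a) - kernel (d, a')) (d', b')| ≤ 2 * d'.1 b b' := by
    have e1 := abs_kernel_sub_le d' b b' (d, a)
    have e2 := abs_kernel_sub_le d' b b' (d, a')
    rw [kernel_comm _ (d, a), kernel_comm _ (d, a)] at e1
    rw [kernel_comm _ (d, a'), kernel_comm _ (d, a')] at e2
    simp only [Pi.sub_apply]
    rw [abs_le] at *
    constructor <;> linarith
  refine abs_le_of_sq_le_sq ?_ (by positivity)
  rw [mul_pow, mul_pow, Real.sq_sqrt (d.2.nonneg _ _), Real.sq_sqrt (d'.2.nonneg _ _), ← sq_abs]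
  nlinarith [mul_le_mul h1 h2 (abs_nonneg _) (by linarith [d.2.nonneg a a'])]

/-- The bilinear form of the kernel. -/
noncomputable def form :
    PseudometricFreeSpace G →ₗ[ℝ] PseudometricFreeSpace G →ₗ[ℝ] ℝ :=
  linearCombination ℝ fun s => linearCombination ℝ (kernel s)

theorem form_apply (x y : PseudometricFreeSpace G) :
    form x y = linearCombination ℝ (fun s => linearCombination ℝ (kernel s) y) x := by
  simp [form, linearCombination_apply, Finsupp.sum, LinearMap.sum_apply]

theorem linearCombination_sub (f g : InvariantPseudometric G × G → ℝ)
    (x : PseudometricFreeSpace G) :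
    linearCombination ℝ (f - g) x = linearCombination ℝ f x - linearCombination ℝ g x := by
  simp [linearCombination_apply, Finsupp.sum, mul_sub]

/-- Pairing the kernel with `y` in one variable leaves a Hölder function of constant `2 * ‖y‖` in
the other, which is then paired with `x`. -/
theorem abs_form_le (x y : PseudometricFreeSpace G) : |form x y| ≤ 2 * ‖x‖ * ‖y‖ := by
  have : (fun s => linearCombination ℝ (kernel s) y) ∈ holderTest G (2 * ‖y‖) := by
    refine ⟨fun s => ?_, fun d a b => ?_⟩
    · linarith [abs_linearCombination_le (kernel_mem_holderTest s) y, norm_nonneg y]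
    · rw [← linearCombination_sub]
      exact (abs_linearCombination_le (kernel_sub_mem_holderTest d a b) y).trans_eq (by ring)
  rw [form_apply]
  exact (abs_linearCombination_le this x).trans_eq (by ring)

theorem continuous_form :
    Continuous fun p : PseudometricFreeSpace G × PseudometricFreeSpace G => form p.1 p.2 :=
  (LinearMap.mkContinuous₂ form 2 abs_form_le).continuous₂

/-- The action by left translation. -/
noncomputable def act : G →* (PseudometricFreeSpace G →ₗ[ℝ] PseudometricFreeSpace G) where
  toFun g := lmapDomain ℝ ℝ fun s => (s.1, g * s.2)
  map_one' := by ext; simp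
  map_mul' g h := by ext; simp [mul_assoc]

theorem act_single (g : G) (d : InvariantPseudometric G) (a : G) (c : ℝ) :
    act g (single (d, a) c) = single (d, g * a) c :=
  mapDomain_single

theorem linearCombination_act (f : InvariantPseudometric G × G → ℝ) (g : G)
    (x : PseudometricFreeSpace G) :
    linearCombination ℝ f (act g x) = linearCombination ℝ (fun s => f (s.1, g * s.2)) x :=
  linearCombination_mapDomain ℝ _ _

theorem form_act (g : G) (x y : PseudometricFreeSpace G) :
    form (act g x) (act g y) = form x y := by
  have h : ∀ s : InvariantPseudometric G × G,
      (fun t : InvariantPseudometric G × G => kernel (s.1, g * s.2) (t.1, g * t.2)) = kernel s :=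
    fun s => funext fun t => by simp only [kernel, s.1.2.mul_left]
  simp only [form_apply, linearCombination_act, h]

theorem norm_act_le (g : G) (x : PseudometricFreeSpace G) : ‖act g x‖ ≤ ‖x‖ := by
  refine norm_le fun f hf => ?_
  rw [linearCombination_act, ← one_mul ‖x‖]
  refine abs_linearCombination_le ⟨fun s => hf.1 _, fun d a b => ?_⟩ x
  rw [← d.2.mul_left g a b]
  exact hf.2 d _ _

theorem norm_single_sub_single_le (d : InvariantPseudometric G) (a b : G) (c : ℝ) :
    ‖(single (d, a) c - single (d, b) c : PseudometricFreeSpace G)‖ ≤ |c| * √(d.1 a b) := by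
  refine norm_le fun f hf => ?_
  rw [map_sub, linearCombination_single, linearCombination_single, ← smul_sub, smul_eq_mul, abs_mul]
  gcongr
  simpa using hf.2 d a b

theorem tendsto_act_one [IsTopologicalGroup G] (x : PseudometricFreeSpace G) :
    Tendsto (fun g => ‖act g x - x‖) (𝓝 1) (𝓝 0) := by
  induction x using Finsupp.induction_linear with
  | zero => simp
  | add x y hx hy =>
    refine squeeze_zero (fun _ => norm_nonneg _) (fun g => ?_) (by simpa using hx.add hy)
    rw [map_add, add_sub_add_comm]
    exact norm_add_le _ _
  | single s c =>
    obtain ⟨d, a⟩ := s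
    -- Only left invariance is available, so the distance from `g * a` to `a` becomes that from 1 to
    -- a conjugate of `g`.
    have h1 : Tendsto (fun g => a⁻¹ * g * a) (𝓝 1) (𝓝 1) := by
      have : Continuous (fun g => a⁻¹ * g * a) := by fun_prop
      simpa using this.tendsto 1
    have h2 : Tendsto (fun g => |c| * √(d.1 1 (a⁻¹ * g * a))) (𝓝 1) (𝓝 0) := by
      simpa using ((d.2.tendsto.comp h1).sqrt).const_mul |c|
    refine squeeze_zero (fun _ => norm_nonneg _) (fun g => ?_) h2
    rw [act_single]
    refine (norm_single_sub_single_le d _ _ c).trans_eq ?_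
    rw [← d.2.mul_left a 1, d.2.symm]
    simp [mul_assoc]

/-- The operators do not increase the norm, so joint continuity reduces to continuity of each orbit
map at 1. -/
theorem continuous_act [IsTopologicalGroup G] :
    Continuous fun p : G × PseudometricFreeSpace G => act p.1 p.2 := by
  rw [continuous_iff_continuousAt]
  rintro ⟨g, x⟩
  rw [ContinuousAt, tendsto_iff_norm_sub_tendsto_zero]
  have h1 : Tendsto (fun p : G × PseudometricFreeSpace G => ‖act (g⁻¹ * p.1) x - x‖)
      (𝓝 (g, x)) (𝓝 0) := by
    refine (tendsto_act_one x).comp ?_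
    have : Continuous (fun p : G × PseudometricFreeSpace G => g⁻¹ * p.1) := by fun_prop
    simpa using this.tendsto (g, x)
  have h2 : Tendsto (fun p : G × PseudometricFreeSpace G => ‖p.2 - x‖) (𝓝 (g, x)) (𝓝 0) := by
    have : Continuous (fun p : G × PseudometricFreeSpace G => ‖p.2 - x‖) := by fun_prop
    simpa using this.tendsto (g, x)
  have h3 := h1.add h2
  rw [add_zero] at h3
  refine squeeze_zero (fun _ => norm_nonneg _) (fun p => ?_) h3
  have : act p.1 p.2 - act g x = act g (act (g⁻¹ * p.1) x - x) + act p.1 (p.2 - x) := by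
    rw [map_sub, map_sub, ← Module.End.mul_apply, ← map_mul, mul_inv_cancel_left]
    abel
  rw [this]
  exact (norm_add_le _ _).trans (add_le_add (norm_act_le _ _) (norm_act_le _ _))

variable (G) in
/-- The free space with its translation action and kernel form. -/
noncomputable def invariantForm [IsTopologicalGroup G] :
    InvariantBilinForm G (PseudometricFreeSpace G) where
  act := act
  form := form
  form_act := form_act
  continuous_act := continuous_act
  continuous_form := continuous_form

theorem exists_form_detects [IsTopologicalGroup G] {U : Set G} (hU : U ∈ 𝓝 1) :
    ∃ x y : PseudometricFreeSpace G, ∃ ε > 0, ∀ g,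
      |(invariantForm G).form ((invariantForm G).act g x - x) y| < ε → g ∈ U := by
  obtain ⟨d, hd, ε, hε, h⟩ := IsInvariantPseudometric.exists_of_mem_nhds_one hU
  refine ⟨single (⟨d, hd⟩, 1) 1, single (⟨d, hd⟩, 1) 1, ε, hε, fun g hg => h g ?_⟩
  simp only [invariantForm, act_single, mul_one, form_apply, map_sub, LinearMap.sub_apply,
    linearCombination_single,
    one_smul, kernel, if_true, hd.self, sub_zero, abs_of_nonneg (hd.nonneg _ _)] at hg
  rwa [hd.symm]

end PseudometricFreeSpace

/-! ### Embedding into a single factor -/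

namespace HausdorffTopGroup

theorem isomorphicToSubgroup_iff {G K : Type*} [Group G] [TopologicalSpace G]
    [Group K] [TopologicalSpace K] :
    IsomorphicToSubgroup G K ↔ ∃ f : G →* K, IsEmbedding f := by
  constructor
  · rintro ⟨H, ⟨e⟩⟩
    exact ⟨H.subtype.comp e.toMulEquiv.toMonoidHom,
      IsEmbedding.subtypeVal.comp e.toHomeomorph.isEmbedding⟩
  · rintro ⟨f, hf⟩
    let e : G ≃* f.range := MonoidHom.ofInjective hf.injective
    let e' : G ≃ₜ range f := hf.toHomeomorph
    exact ⟨f.range, ⟨{ e with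
      continuous_toFun := e'.continuous
      continuous_invFun := by
        have : (e.symm : f.range → G) = e'.symm := funext fun y => by
          obtain ⟨x, rfl⟩ := e.surjective y
          rw [MulEquiv.symm_apply_apply]
          exact (e'.symm_apply_apply x).symm
        change Continuous (e.symm : f.range → G)
        rw [this]
        exact e'.symm.continuous }⟩⟩

/-- Every Hausdorff topological group embeds in a Hausdorff topological group `K` with an element
`z` such that the continuous homomorphisms on `K` that do not kill `z` are embeddings on `G`. -/
theorem exists_detecting_extension (G : HausdorffTopGroup.{u}) :
    ∃ (K : HausdorffTopGroup.{u}) (i : G →* K) (z : K), z ≠ 1 ∧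
      ∀ (F : HausdorffTopGroup.{u}) (φ : K →* F), Continuous φ → φ z ≠ 1 →
        IsEmbedding (φ.comp i) := by
  let D := PseudometricFreeSpace.invariantForm G
  let H := InvariantBilinForm.Heisenberg D
  -- Only a seminorm is at hand on the free space, so `H` is replaced by its Hausdorff quotient; `z`
  -- survives because the central coordinate is continuous.
  let q : H →* SeparationQuotient H := SeparationQuotient.mkMonoidHom
  have hq : Continuous q := SeparationQuotient.continuous_mk
  refine ⟨⟨SeparationQuotient H⟩, q.comp InvariantBilinForm.Heisenberg.inl, q ⟨1, 0, 0, 1⟩, ?_, ?_⟩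
  · intro h
    have h' : Inseparable (⟨1, 0, 0, 1⟩ : H) 1 := SeparationQuotient.mk_eq_mk.1 h
    exact one_ne_zero (h'.map InvariantBilinForm.Heisenberg.continuous_center).eq
  · intro F φ hφ hz
    exact (InvariantBilinForm.Heisenberg.isInducing_comp_inl
      (fun _ => PseudometricFreeSpace.exists_form_detects) (φ.comp q) (hφ.comp hq) hz).isEmbedding

theorem exists_isomorphicToSubgroup_of_pi {𝒢 : Set HausdorffTopGroup.{u}}
    (h : ∀ G : HausdorffTopGroup.{u}, ∃ (ι : Type u) (F : ι → HausdorffTopGroup.{u}),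
      (∀ i, F i ∈ 𝒢) ∧ IsomorphicToSubgroup G (∀ i, F i)) (G : HausdorffTopGroup.{u}) :
    ∃ K ∈ 𝒢, IsomorphicToSubgroup G K := by
  obtain ⟨K, j, z, hz, hK⟩ := exists_detecting_extension G
  obtain ⟨ι, F, hF, hKF⟩ := h K
  obtain ⟨f, hf⟩ := isomorphicToSubgroup_iff.1 hKF
  obtain ⟨i, hi⟩ : ∃ i, f z i ≠ 1 := by
    by_contra! hall
    exact hz (hf.injective ((funext hall).trans (map_one f).symm))
  exact ⟨F i, hF i, isomorphicToSubgroup_iff.2 ⟨_, hK (F i)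
    ((Pi.evalMonoidHom (fun i => (F i : Type u)) i).comp f)
    ((continuous_apply i).comp hf.continuous) hi⟩⟩

end HausdorffTopGroup

theorem mainTheorem1 (𝒢 : Set HausdorffTopGroup.{u}) :
    ((∀ G : HausdorffTopGroup.{u}, ∃ (ι : Type u) (F : ι → HausdorffTopGroup.{u}),
        (∀ i, F i ∈ 𝒢) ∧ HausdorffTopGroup.IsomorphicToSubgroup G (∀ i, F i)) →
      ∀ G : HausdorffTopGroup.{u}, ∃ K ∈ 𝒢, HausdorffTopGroup.IsomorphicToSubgroup G K) ∧
    (HausdorffTopGroup.S (HausdorffTopGroup.P 𝒢) = Set.univ →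
      HausdorffTopGroup.S 𝒢 = Set.univ) := by
  refine ⟨HausdorffTopGroup.exists_isomorphicToSubgroup_of_pi, fun h =>
    eq_univ_of_forall (HausdorffTopGroup.exists_isomorphicToSubgroup_of_pi fun G => ?_)⟩
  obtain ⟨K, ⟨ι, F, hF, ⟨e⟩⟩, hGK⟩ : G ∈ HausdorffTopGroup.S (HausdorffTopGroup.P 𝒢) :=
    h ▸ mem_univ G
  obtain ⟨f, hf⟩ := HausdorffTopGroup.isomorphicToSubgroup_iff.1 hGK
  exact ⟨ι, F, hF, HausdorffTopGroup.isomorphicToSubgroup_iff.2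
    ⟨e.toMulEquiv.toMonoidHom.comp f, e.toHomeomorph.isEmbedding.comp hf⟩⟩
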